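/- Let $d\ge 2$, let $\{|i\rangle\}_{i=1}^d$ be the fixed reference basis of $\mathbb C^d$ (a qudit), and let $\rho$ be any density matrix on $\mathbb C^d$. The coherence rank $\mathrm{CR}(|\psi\rangle)$ is the number of nonzero coefficients of $|\psi\rangle$ in this basis, and the coherence number is $\mathrm{CN}(\rho)=\min\max_i \mathrm{CR}(|\psi_i\rangle)$, the minimum being over all finite decompositions $\rho=\sum_i p_i|\psi_i\rangle\langle\psi_i|$ into pure states with $p_i>0$. A pure state of several parties is $k$-producible if it is a tensor product of pure states each pertaining to at most $k$ parties; a mixed state is $k$-producible if it is a convex combination of $k$-producible pure states; its entanglement depth $\mathrm{ED}$ is the least $k$ for which it is $k$-producible. Adjoin $d$ qubits in the state $|0\rangle^{\otimes d}$ and set $\rho'=U_A(\rho\otimes|0\rangle\langle 0|^{\otimes d})U_A^\dagger$, where $U_A=\sum_{i=1}^d |i\rangle\langle i|\otimes \mathbb 1_2^{\otimes i-1}\otimes\sigma_x\otimes\mathbb 1_2^{\otimes d-i}$. Let $\mathrm{QFT}$ be the qudit unitary $|j\rangle\mapsto d^{-1/2}\sum_{m=1}^d e^{2\pi i jm/d}|m\rangle$,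 let $U_D^{(m)}=\bigotimes_{j=1}^d\left(|0\rangle\langle 0|+e^{-2\pi i jm/d}|1\rangle\langle 1|\right)$ on the qubits, let $U_D=\sum_{m=1}^d|m\rangle\langle m|\otimes U_D^{(m)}$, and let $U_B=U_D(\mathrm{QFT}\otimes\mathbb 1)$. Let $\Delta$ be the one-way LOCC map that applies $\mathrm{QFT}$ to the qudit, measures the qudit in the basis $\{|m\rangle\}$, applies $U_D^{(m)}$ to the qubits upon outcome $m$, and discards the qudit (and the outcome). Put $\rho''=\Delta(\rho')$, a state of the $d$ qubits. Then $U_B\,\rho'\,U_B^\dagger=|\Phi^+\rangle\langle\Phi^+|\otimes\rho''$ with $|\Phi^+\rangle=d^{-1/2}\sum_{i=1}^d|i\rangle$; in particular, both ways of decoupling the qudit ($U_B$ followed by the partial trace over the qudit, or $\Delta$) leave the qubits in the state $\rho''$. Moreover, for every $2\le k\le d$ the following are equivalent: (i) $\mathrm{CN}(\rho)=k$; (ii) $\mathrm{ED}(\rho')=k+1$, where $\rho'$ is regarded as a state of $d+1$ parties (the qudit and the $d$ qubits); (iii) $\mathrm{ED}(\rho'')=k$, where $\rho''$ is regarded as a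 state of $d$ parties (the $d$ qubits), and where $\rho''$ is obtained by either of the two ways of decoupling. -/

import Mathlib

open scoped Kronecker ComplexOrder

namespace CoherenceConversion

noncomputable section

/-! ### States and pure-state decompositions -/

/-- Density matrices: positive semidefinite matrices of trace one. -/
def IsDensityMatrix {X : Type*} [Fintype X] (ρ : Matrix X X ℂ) : Prop :=
  ρ.PosSemidef ∧ ρ.trace = 1

/-- Pure states: vectors of Euclidean norm one. -/
def IsPureState {X : Type*} [Fintype X] (ψ : X → ℂ) : Prop :=
  ∑ x, ‖ψ x‖ ^ 2 = 1

/-- The rank-one operator `|ψ⟩⟨ψ|`. -/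
def ketBra {X : Type*} (ψ : X → ℂ) : Matrix X X ℂ :=
  Matrix.vecMulVec ψ (star ψ)

/-- `ρ = ∑ i, p i |ψ i⟩⟨ψ i|` is a convex decomposition of `ρ` into finitely many pure states
that all occur with nonzero probability. -/
structure IsPureDecomposition {X : Type*} [Fintype X] (ρ : Matrix X X ℂ) {N : ℕ}
    (p : Fin N → ℝ) (ψ : Fin N → X → ℂ) : Prop where
  prob_pos : ∀ i, 0 < p i
  prob_sum : ∑ i, p i = 1
  pure : ∀ i, IsPureState (ψ i)
  eq_sum : ρ = ∑ i, (p i : ℂ) • ketBra (ψ i)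

/-! ### Coherence number -/

/-- Coherence rank: the number of nonzero coefficients in the reference basis. -/
def coherenceRank {X : Type*} (ψ : X → ℂ) : ℕ :=
  Set.ncard {x | ψ x ≠ 0}

/-- Coherence number: the minimum, over all pure-state decompositions, of the largest coherence
rank that occurs in the decomposition. -/
def coherenceNumber {X : Type*} [Fintype X] (ρ : Matrix X X ℂ) : ℕ :=
  sInf {r | ∃ (N : ℕ) (p : Fin N → ℝ) (ψ : Fin N → X → ℂ), IsPureDecomposition ρ p ψ ∧
    r = Finset.univ.sup fun i => coherenceRank (ψ i)}

/-! ### Entanglement depth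

The parties are indexed by `ι`; the party `i` has the basis `κ i`, so that the tensor product of
the local spaces has the basis `∀ i, κ i`. -/

section Depth

variable {ι : Type*} [Fintype ι] [DecidableEq ι] {κ : ι → Type*} [∀ i, Fintype (κ i)]

/-- A pure state is `k`-producible if it is a tensor product of pure states, each of which
pertains to at most `k` parties: the parties are partitioned into blocks `B` of size at most `k`,
and `ψ = ⨂ B, φ B`. -/
def IsProduciblePure (k : ℕ) (ψ : (∀ i, κ i) → ℂ) : Prop :=
  ∃ (P : Finpartition (Finset.univ : Finset ι))
    (φ : ∀ B : Finset ι, (∀ i : B, κ i) → ℂ),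
    (∀ B ∈ P.parts, B.card ≤ k ∧ IsPureState (φ B)) ∧
    ∀ x : ∀ i, κ i, ψ x = ∏ B ∈ P.parts, φ B (fun i => x i)

/-- A mixed state is `k`-producible if it is a convex combination of `k`-producible pure
states. -/
def IsProducible (k : ℕ) (ρ : Matrix (∀ i, κ i) (∀ i, κ i) ℂ) : Prop :=
  ∃ (N : ℕ) (p : Fin N → ℝ) (ψ : Fin N → (∀ i, κ i) → ℂ),
    IsPureDecomposition ρ p ψ ∧ ∀ i, IsProduciblePure k (ψ i)

/-- Entanglement depth: the least `k` for which the state is `k`-producible (so that it is not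
`k - 1`-producible). -/
def entanglementDepth (ρ : Matrix (∀ i, κ i) (∀ i, κ i) ℂ) : ℕ :=
  sInf {k | IsProducible k ρ}

end Depth

/-! ### The systems: one qudit and `d` qubits -/

/-- Basis of the `d` qubits. -/
abbrev Qubits (d : ℕ) : Type := Fin d → Fin 2

/-- Bases of the `d + 1` parties: the qudit is the party `none`, the `j`-th qubit is the party
`some j`. -/
abbrev PartyBasis (d : ℕ) : Option (Fin d) → Type
  | none => Fin d
  | some _ => Fin 2

instance (d : ℕ) : ∀ o, Fintype (PartyBasis d o)
  | none => inferInstanceAs (Fintype (Fin d))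
  | some _ => inferInstanceAs (Fintype (Fin 2))

/-- An operator on qudit and qubits, regarded as an operator on the `d + 1` parties. -/
def asParties {d : ℕ} (σ : Matrix (Fin d × Qubits d) (Fin d × Qubits d) ℂ) :
    Matrix (∀ o, PartyBasis d o) (∀ o, PartyBasis d o) ℂ :=
  σ.submatrix (fun x => (x none, fun j => x (some j))) (fun x => (x none, fun j => x (some j)))

/-- The tensor product `A 0 ⊗ ⋯ ⊗ A (d - 1)` of one-qubit operators. -/
def qubitTensor {d : ℕ} (A : Fin d → Matrix (Fin 2) (Fin 2) ℂ) :
    Matrix (Qubits d) (Qubits d) ℂ :=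
  Matrix.of fun x y => ∏ j, A j (x j) (y j)

/-- The projector `|m⟩⟨m|` of the qudit. -/
def quditProj {d : ℕ} (m : Fin d) : Matrix (Fin d) (Fin d) ℂ :=
  Matrix.single m m 1

/-- The Pauli matrix `σ_x`. -/
def pauliX : Matrix (Fin 2) (Fin 2) ℂ := !![0, 1; 1, 0]

/-! ### The conversion protocol -/

/-- The activation unitary
`U_A = ∑ i, |i⟩⟨i| ⊗ 1 ⊗ ⋯ ⊗ 1 ⊗ σ_x ⊗ 1 ⊗ ⋯ ⊗ 1`, with `σ_x` acting on the `i`-th qubit. -/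
def activation (d : ℕ) : Matrix (Fin d × Qubits d) (Fin d × Qubits d) ℂ :=
  ∑ i : Fin d, quditProj i ⊗ₖ qubitTensor (Function.update (fun _ => 1) i pauliX)

/-- The state `ρ' = U_A (ρ ⊗ |0⟩⟨0|^{⊗ d}) U_A†`. -/
def activated {d : ℕ} (ρ : Matrix (Fin d) (Fin d) ℂ) :
    Matrix (Fin d × Qubits d) (Fin d × Qubits d) ℂ :=
  activation d * (ρ ⊗ₖ qubitTensor fun _ => Matrix.single 0 0 1) * (activation d).conjTranspose

/-- The phase `exp (2 π i j m / d)`; the levels are numbered from `1` to `d`. -/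
def phase {d : ℕ} (j m : Fin d) : ℂ :=
  Complex.exp (2 * Real.pi * Complex.I * ((j : ℂ) + 1) * ((m : ℂ) + 1) / d)

/-- The quantum Fourier transform `|j⟩ ↦ d^{-1/2} ∑ m, exp (2 π i j m / d) |m⟩`. -/
def qft (d : ℕ) : Matrix (Fin d) (Fin d) ℂ :=
  Matrix.of fun m j => (1 / (Real.sqrt d : ℂ)) * phase j m

/-- The local unitary `U_D^{(m)} = ⨂ j, (|0⟩⟨0| + exp (-2 π i j m / d) |1⟩⟨1|)` of the qubits. -/
def qubitPhases {d : ℕ} (m : Fin d) : Matrix (Qubits d) (Qubits d) ℂ :=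
  qubitTensor fun j => Matrix.diagonal ![1, (phase j m)⁻¹]

/-- The disentangling unitary `U_D = ∑ m, |m⟩⟨m| ⊗ U_D^{(m)}`. -/
def disentangling (d : ℕ) : Matrix (Fin d × Qubits d) (Fin d × Qubits d) ℂ :=
  ∑ m : Fin d, quditProj m ⊗ₖ qubitPhases m

/-- The global decoupling unitary `U_B = U_D (QFT ⊗ 1)`. -/
def decoupling (d : ℕ) : Matrix (Fin d × Qubits d) (Fin d × Qubits d) ℂ :=
  disentangling d * (qft d ⊗ₖ (1 : Matrix (Qubits d) (Qubits d) ℂ))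

/-- The unnormalized state `(⟨m| ⊗ 1) σ (|m⟩ ⊗ 1)` of the qubits after the outcome `m` of a
measurement of the qudit in the reference basis. -/
def outcome {d : ℕ} (m : Fin d) (σ : Matrix (Fin d × Qubits d) (Fin d × Qubits d) ℂ) :
    Matrix (Qubits d) (Qubits d) ℂ :=
  σ.submatrix (Prod.mk m) (Prod.mk m)

/-- Partial trace over the qudit. -/
def traceQudit {d : ℕ} (σ : Matrix (Fin d × Qubits d) (Fin d × Qubits d) ℂ) :
    Matrix (Qubits d) (Qubits d) ℂ :=
  ∑ m, outcome m σ

/-- The one-way LOCC map `Δ`: Fourier transform the qudit, measure it in the reference basis,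
apply the local unitary `U_D^{(m)}` to the qubits if the outcome is `m`, and discard the qudit. -/
def oneWayLOCC {d : ℕ} (σ : Matrix (Fin d × Qubits d) (Fin d × Qubits d) ℂ) :
    Matrix (Qubits d) (Qubits d) ℂ :=
  ∑ m : Fin d, qubitPhases m *
    outcome m ((qft d ⊗ₖ (1 : Matrix (Qubits d) (Qubits d) ℂ)) * σ *
      (qft d ⊗ₖ (1 : Matrix (Qubits d) (Qubits d) ℂ)).conjTranspose) *
    (qubitPhases m).conjTranspose

/-- The maximally coherent qudit state `|Φ⁺⟩ = d^{-1/2} ∑ i, |i⟩`. -/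
def maxCoherent (d : ℕ) : Fin d → ℂ := fun _ => 1 / (Real.sqrt d : ℂ)

end

end CoherenceConversion

/-! Every state here is `ρ` transported along an isometry that sends basis vectors to basis vectors.
Write `e_j` for the qubit basis state with only qubit `j` excited. The activation sends `|j⟩|0⋯0⟩`
to `|j⟩|e_j⟩`. The Fourier transform then attaches to `|m⟩|e_j⟩` a phase depending only on `j` and
`m`; since `e_j` remembers `j`, the local qubit phases cancel it. What remains is `|Φ⁺⟩|e_j⟩`, so
the qudit factors out and `ρ''` is `ρ` embedded by `j ↦ e_j`.

Pure decompositions of an embedded operator are exactly the embedded decompositions of `ρ`, because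
a vanishing diagonal entry forces every vector of the decomposition to vanish there
(`IsPureDecomposition.restrict`). This reduces the equivalences to pure states
(`isProducible_embedOperator_iff`).

For pure states, the support of a product vector is closed under exchanging labels on a block
(`exchange_ne_zero`). One-excitation states are not closed under such exchanges if their excitations
lie in different blocks, so one block contains all excited qubits, and also the qudit if it carries
the label `j` and at least two labels occur. Conversely, parties outside the support are in fixed
basis states and split off (`isProduciblePure_of_support`). -/

namespace CoherenceConversion

/-! ### Pure-state decompositions along an embedding of basis states -/

section Embedding

variable {X Y : Type*} [Fintype X] [DecidableEq Y]

/-- The matrix of the linear map that sends the basis vector `x` to the basis vector `ε x`. -/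
def basisEmbedding (ε : X → Y) : Matrix Y X ℂ :=
  Matrix.of fun y x => if y = ε x then 1 else 0

/-- The operator `ρ` transported along the embedding `ε` of basis states. -/
def embedOperator (ε : X → Y) (ρ : Matrix X X ℂ) : Matrix Y Y ℂ :=
  basisEmbedding ε * ρ * (basisEmbedding ε).conjTranspose

lemma embedOperator_apply (ε : X → Y) (ρ : Matrix X X ℂ) (y y' : Y) :
    embedOperator ε ρ y y' =
      ∑ i, (∑ j, (if y = ε j then 1 else 0) * ρ j i) * (if y' = ε i then 1 else 0) := by
  simp only [embedOperator, basisEmbedding, Matrix.mul_apply, Matrix.of_apply,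
    Matrix.conjTranspose_apply]
  refine Finset.sum_congr rfl fun i _ => ?_
  split_ifs <;> simp

lemma embedOperator_apply_apply {ε : X → Y} (hε : Function.Injective ε) (ρ : Matrix X X ℂ)
    (i j : X) : embedOperator ε ρ (ε i) (ε j) = ρ i j := by
  classical
  simp [embedOperator_apply, hε.eq_iff]

lemma embedOperator_apply_left {ε : X → Y} (ρ : Matrix X X ℂ) {y : Y} (hy : y ∉ Set.range ε)
    (y' : Y) : embedOperator ε ρ y y' = 0 := by
  have h : ∀ x, y ≠ ε x := fun x hx => hy ⟨x, hx.symm⟩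
  simp [embedOperator_apply, h]

lemma embedOperator_apply_right {ε : X → Y} (ρ : Matrix X X ℂ) (y : Y) {y' : Y}
    (hy : y' ∉ Set.range ε) : embedOperator ε ρ y y' = 0 := by
  have h : ∀ x, y' ≠ ε x := fun x hx => hy ⟨x, hx.symm⟩
  simp [embedOperator_apply, h]

variable [Fintype Y]

omit [DecidableEq Y] in
lemma sum_extend_norm_sq {ε : X → Y} (hε : Function.Injective ε) (ψ : X → ℂ) :
    ∑ y, ‖Function.extend ε ψ 0 y‖ ^ 2 = ∑ x, ‖ψ x‖ ^ 2 := by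
  symm
  refine Finset.sum_of_injOn ε hε.injOn (by simp) ?_ ?_
  · intro y _ hy
    rw [Function.extend_apply' _ _ _ (by simpa using hy)]
    simp
  · intro x _
    rw [hε.extend_apply]

omit [DecidableEq Y] in
lemma isPureState_extend {ε : X → Y} (hε : Function.Injective ε) {ψ : X → ℂ} :
    IsPureState (Function.extend ε ψ 0) ↔ IsPureState ψ := by
  rw [IsPureState, IsPureState, sum_extend_norm_sq hε]

lemma IsPureDecomposition.extend {ε : X → Y} (hε : Function.Injective ε) {ρ : Matrix X X ℂ}
    {N : ℕ} {p : Fin N → ℝ} {ψ : Fin N → X → ℂ} (h : IsPureDecomposition ρ p ψ) :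
    IsPureDecomposition (embedOperator ε ρ) p fun i => Function.extend ε (ψ i) 0 := by
  refine ⟨h.prob_pos, h.prob_sum, fun i => (isPureState_extend hε).2 (h.pure i), ?_⟩
  ext y y'
  by_cases hy : y ∈ Set.range ε
  · by_cases hy' : y' ∈ Set.range ε
    · obtain ⟨i, rfl⟩ := hy
      obtain ⟨j, rfl⟩ := hy'
      rw [embedOperator_apply_apply hε, h.eq_sum]
      simp [Matrix.sum_apply, ketBra, Matrix.vecMulVec_apply, hε.extend_apply]
    · rw [embedOperator_apply_right _ _ hy']
      simp [Matrix.sum_apply, ketBra, Matrix.vecMulVec_apply,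
        Function.extend_apply' _ _ _ hy']
  · rw [embedOperator_apply_left _ hy]
    simp [Matrix.sum_apply, ketBra, Matrix.vecMulVec_apply, Function.extend_apply' _ _ _ hy]

-- The diagonal entry at `y` is the sum of the `p i * ‖χ i y‖ ^ 2`; as the weights are strictly
-- positive, it vanishes only if every term does.
omit [DecidableEq Y] in
lemma IsPureDecomposition.eq_zero {σ : Matrix Y Y ℂ} {N : ℕ} {p : Fin N → ℝ}
    {χ : Fin N → Y → ℂ} (h : IsPureDecomposition σ p χ) {y : Y} (hy : σ y y = 0) (i : Fin N) :
    χ i y = 0 := by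
  have hsum : ∑ i, p i * ‖χ i y‖ ^ 2 = 0 := by
    rw [h.eq_sum] at hy
    simp only [Matrix.sum_apply, Matrix.smul_apply, ketBra, Matrix.vecMulVec_apply,
      Pi.star_apply, RCLike.star_def, Complex.mul_conj', smul_eq_mul] at hy
    exact_mod_cast hy
  have := (Finset.sum_eq_zero_iff_of_nonneg
    fun i _ => mul_nonneg (h.prob_pos i).le (sq_nonneg _)).1 hsum i (Finset.mem_univ i)
  simpa [(h.prob_pos i).ne'] using this

/-- The diagonal of the embedded operator vanishes off the range of `ε`, so no vector of the
decomposition can leave that range, and restricting along `ε` loses nothing. -/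
lemma IsPureDecomposition.restrict {ε : X → Y} (hε : Function.Injective ε) {ρ : Matrix X X ℂ}
    {N : ℕ} {p : Fin N → ℝ} {χ : Fin N → Y → ℂ}
    (h : IsPureDecomposition (embedOperator ε ρ) p χ) :
    IsPureDecomposition ρ p (fun i => χ i ∘ ε) ∧
      ∀ i, Function.extend ε (χ i ∘ ε) 0 = χ i := by
  have hχ : ∀ i, Function.extend ε (χ i ∘ ε) 0 = χ i := by
    intro i
    ext y
    by_cases hy : y ∈ Set.range ε
    · obtain ⟨x, rfl⟩ := hy
      rw [hε.extend_apply, Function.comp_apply]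
    · rw [Function.extend_apply' _ _ _ hy, h.eq_zero (embedOperator_apply_left ρ hy y)]
      rfl
  refine ⟨⟨h.prob_pos, h.prob_sum, fun i => ?_, ?_⟩, hχ⟩
  · rw [← isPureState_extend hε, hχ]
    exact h.pure i
  · ext i j
    rw [← embedOperator_apply_apply hε ρ, h.eq_sum]
    simp [Matrix.sum_apply, ketBra, Matrix.vecMulVec_apply]

end Embedding

/-! ### Producibility of pure states -/

section Producible

variable {ι : Type*} [Fintype ι] [DecidableEq ι] {κ : ι → Type*} [∀ i, Fintype (κ i)]

omit [∀ i, Fintype (κ i)] in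
/-- If `ψ` is a product over a partition, then exchanging the local labels of two basis states in
its support on one of the blocks does not leave the support. -/
lemma exchange_ne_zero {P : Finpartition (Finset.univ : Finset ι)}
    {φ : ∀ B : Finset ι, (∀ i : B, κ i) → ℂ} {ψ : (∀ i, κ i) → ℂ}
    (hψ : ∀ x : ∀ i, κ i, ψ x = ∏ B ∈ P.parts, φ B (fun i => x i))
    {x y : ∀ i, κ i} (hx : ψ x ≠ 0) (hy : ψ y ≠ 0) {B : Finset ι} (hB : B ∈ P.parts) :
    ψ (fun i => if i ∈ B then x i else y i) ≠ 0 := by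
  -- Nonvanishing can be tested block by block: on `B` the factor is that of `x`, on any other block
  -- it is that of `y`.
  rw [hψ, Finset.prod_ne_zero_iff] at hx hy ⊢
  intro C hC
  by_cases h : C = B
  · subst h
    have : (fun i : C => if (i : ι) ∈ C then x i else y i) = fun i : C => x i := by
      ext i
      simp
    rw [this]
    exact hx C hC
  · have hd : Disjoint C B := P.disjoint hC hB h
    have : (fun i : C => if (i : ι) ∈ B then x i else y i) = fun i : C => y i := by
      ext i
      rw [if_neg (Finset.disjoint_left.1 hd i.2)]
    rw [this]
    exact hy C hC

/-- A pure state whose support is constant outside a nonempty set `S` of parties is a product of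
a state of `S` and of basis states of the other parties. -/
lemma isProduciblePure_of_support {k : ℕ} {ψ : (∀ i, κ i) → ℂ} (hψ : IsPureState ψ)
    (S : Finset ι) (hS : S.Nonempty) (hSk : S.card ≤ k) (b : ∀ i, κ i)
    (h : ∀ x, ψ x ≠ 0 → ∀ i ∉ S, x i = b i) : IsProduciblePure k ψ := by
  classical
  -- The blocks are `S` and the singletons of its complement.
  let P : Finpartition (Finset.univ : Finset ι) :=
    (⊥ : Finpartition Sᶜ).extend (b := S) hS.ne_empty disjoint_compl_left (by simp)
  let ext : ∀ B : Finset ι, (∀ i : B, κ i) → ∀ i, κ i :=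
    fun B z i => if hi : i ∈ B then z ⟨i, hi⟩ else b i
  have hP : P.parts = insert S (Sᶜ.map ⟨singleton, Finset.singleton_injective⟩) := rfl
  have hS' : S ∉ Sᶜ.map ⟨singleton, Finset.singleton_injective⟩ := by
    simp only [Finset.mem_map, Finset.mem_compl, Function.Embedding.coeFn_mk, not_exists, not_and]
    rintro i hi rfl
    simp at hi
  -- On `S` the factor is `ψ` with the outside labels frozen at `b`; on a singleton it is the basis
  -- state given by `b`.
  refine ⟨P, fun B z => if B = S then ψ (ext B z) else if ∀ i, z i = b i then 1 else 0, ?_, ?_⟩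
  · intro B hB
    rw [hP, Finset.mem_insert] at hB
    by_cases hBS : B = S
    · subst hBS
      refine ⟨hSk, ?_⟩
      rw [IsPureState] at hψ ⊢
      rw [← hψ]
      simp only [if_true]
      refine Finset.sum_of_injOn (ext B) ?_ (by simp) ?_ fun _ _ => rfl
      · intro z _ z' _ hz
        ext i
        simpa [ext] using congrFun hz i
      · intro x _ hx
        by_contra hne
        have hne' : ψ x ≠ 0 := fun h0 => hne (by simp [h0])
        refine hx ⟨fun i => x i, by simp, ?_⟩
        ext i
        by_cases hi : i ∈ B
        · simp [ext, hi]
        · simp [ext, hi, h x hne' i hi]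
    · obtain ⟨i, -, hiB⟩ := Finset.mem_map.1 (hB.resolve_left hBS)
      -- Singletons are admissible blocks because `1 ≤ S.card ≤ k`; this is where `S` must be
      -- nonempty.
      refine ⟨le_trans (by simpa [← hiB] using hS.card_pos) hSk, ?_⟩
      simp only [IsPureState, if_neg hBS]
      refine (Finset.sum_eq_single (M := ℝ) (fun j : B => b j) ?_ ?_).trans ?_
      · intro z _ hz
        rw [if_neg fun h' => hz (funext h')]
        simp
      · simp
      · simp
  · intro x
    rw [hP, Finset.prod_insert hS', Finset.prod_map]
    have hsingle : ∀ i ∈ Sᶜ, ({i} : Finset ι) ≠ S := by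
      rintro i hi rfl
      simp at hi
    by_cases hx : ∀ i ∉ S, x i = b i
    · rw [Finset.prod_eq_one]
      · simp only [if_true, mul_one]
        congr 1
        ext i
        by_cases hi : i ∈ S
        · simp [ext, hi]
        · simp [ext, hi, hx i hi]
      · intro i hi
        simp only [Function.Embedding.coeFn_mk]
        rw [if_neg (hsingle i hi), if_pos]
        rintro ⟨j, hj⟩
        obtain rfl := Finset.mem_singleton.1 hj
        exact hx j (by simpa using hi)
    · have h0 : ψ x = 0 := by
        by_contra hne
        exact hx (h x hne)
      push Not at hx
      obtain ⟨i, hi, hne⟩ := hx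
      rw [h0, Finset.prod_eq_zero (Finset.mem_compl.2 hi), mul_zero]
      simp only [Function.Embedding.coeFn_mk]
      rw [if_neg (hsingle i (Finset.mem_compl.2 hi)), if_neg]
      exact fun h' => hne (h' ⟨i, Finset.mem_singleton_self i⟩)

lemma IsProduciblePure.mono {k l : ℕ} (hkl : k ≤ l) {ψ : (∀ i, κ i) → ℂ}
    (h : IsProduciblePure k ψ) : IsProduciblePure l ψ := by
  obtain ⟨P, φ, h₁, h₂⟩ := h
  exact ⟨P, φ, fun B hB => ⟨(h₁ B hB).1.trans hkl, (h₁ B hB).2⟩, h₂⟩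

lemma IsProducible.mono {k l : ℕ} (hkl : k ≤ l) {ρ : Matrix (∀ i, κ i) (∀ i, κ i) ℂ}
    (h : IsProducible k ρ) : IsProducible l ρ := by
  obtain ⟨N, p, ψ, hd, hψ⟩ := h
  exact ⟨N, p, ψ, hd, fun i => (hψ i).mono hkl⟩

/-- Producibility is upward closed in `k`, so the infimum is located by two consecutive levels. A
successor value also excludes `sInf ∅ = 0`. -/
lemma entanglementDepth_eq_succ_iff {ρ : Matrix (∀ i, κ i) (∀ i, κ i) ℂ} {k : ℕ} :
    entanglementDepth ρ = k + 1 ↔ IsProducible (k + 1) ρ ∧ ¬ IsProducible k ρ :=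
  Nat.sInf_upward_closed_eq_succ_iff (s := {k | IsProducible k ρ})
    (fun _ _ h₁ h₂ => IsProducible.mono h₁ h₂) k

lemma isProducible_embedOperator_iff [∀ i, DecidableEq (κ i)] {X : Type*} [Fintype X]
    {ε : X → ∀ i, κ i} (hε : Function.Injective ε) {k r : ℕ}
    (h : ∀ ψ : X → ℂ, IsPureState ψ →
      (IsProduciblePure k (Function.extend ε ψ 0) ↔ coherenceRank ψ ≤ r))
    {ρ : Matrix X X ℂ} :
    IsProducible k (embedOperator ε ρ) ↔
      ∃ (N : ℕ) (p : Fin N → ℝ) (ψ : Fin N → X → ℂ), IsPureDecomposition ρ p ψ ∧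
        ∀ i, coherenceRank (ψ i) ≤ r := by
  constructor
  · rintro ⟨N, p, χ, hd, hχ⟩
    obtain ⟨hd', he⟩ := hd.restrict hε
    refine ⟨N, p, _, hd', fun i => (h _ (hd'.pure i)).1 ?_⟩
    rw [he]
    exact hχ i
  · rintro ⟨N, p, ψ, hd, hψ⟩
    exact ⟨N, p, _, hd.extend hε, fun i => (h _ (hd.pure i)).2 (hψ i)⟩

end Producible

/-- Puts the coherence number in the same two-level form as the depth, so that the two can be
compared level by level. -/
lemma coherenceNumber_eq_succ_iff {X : Type*} [Fintype X] {ρ : Matrix X X ℂ} {k : ℕ} :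
    coherenceNumber ρ = k + 1 ↔
      (∃ (N : ℕ) (p : Fin N → ℝ) (ψ : Fin N → X → ℂ), IsPureDecomposition ρ p ψ ∧
        ∀ i, coherenceRank (ψ i) ≤ k + 1) ∧
      ¬ ∃ (N : ℕ) (p : Fin N → ℝ) (ψ : Fin N → X → ℂ), IsPureDecomposition ρ p ψ ∧
        ∀ i, coherenceRank (ψ i) ≤ k := by
  constructor
  · intro h
    -- A positive infimum cannot be the default value for the empty set, so an optimal decomposition
    -- exists.
    have hne := Nat.nonempty_of_pos_sInf (lt_of_lt_of_eq k.succ_pos h.symm)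
    obtain ⟨N, p, ψ, hd, hr⟩ := Nat.sInf_mem hne
    refine ⟨⟨N, p, ψ, hd, fun i => ?_⟩, ?_⟩
    · rw [← h, coherenceNumber, hr]
      exact Finset.le_sup (f := fun i => coherenceRank (ψ i)) (Finset.mem_univ i)
    · rintro ⟨N, p, ψ, hd, hψ⟩
      have h₁ : coherenceNumber ρ ≤ _ := Nat.sInf_le ⟨N, p, ψ, hd, rfl⟩
      have h₂ : (Finset.univ.sup fun i => coherenceRank (ψ i)) ≤ k :=
        Finset.sup_le fun i _ => hψ i
      omega
  · rintro ⟨⟨N, p, ψ, hd, hψ⟩, hn⟩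
    refine le_antisymm ?_ ?_
    · have hle : coherenceNumber ρ ≤ _ := Nat.sInf_le ⟨N, p, ψ, hd, rfl⟩
      exact hle.trans (Finset.sup_le fun i _ => hψ i)
    · refine le_csInf ⟨_, N, p, ψ, hd, rfl⟩ ?_
      rintro r ⟨N, p, ψ, hd, rfl⟩
      by_contra hlt
      exact hn ⟨N, p, ψ, hd, fun i => (Finset.le_sup (f := fun i => coherenceRank (ψ i))
        (Finset.mem_univ i)).trans (by omega)⟩

/-! ### The states with one excited qubit -/

section Excitation

variable {d : ℕ}

/-- The basis state of the qubits in which exactly the `j`-th qubit is excited. -/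
def excited (j : Fin d) : Qubits d := Pi.single j 1

/-- The state `|j⟩` of the qudit together with the excited `j`-th qubit. -/
def taggedExcited (j : Fin d) : ∀ o, PartyBasis d o
  | none => j
  | some i => excited j i

lemma excited_apply_eq_one {i j : Fin d} : excited j i = 1 ↔ i = j := by
  by_cases h : i = j <;> simp [excited, h]

lemma excited_apply_of_ne {i j : Fin d} (h : i ≠ j) : excited j i = 0 := by
  simp [excited, h]

lemma excited_injective : Function.Injective (excited (d := d)) := fun _ _ h =>
  excited_apply_eq_one.1 (h ▸ excited_apply_eq_one.2 rfl)

lemma taggedExcited_injective : Function.Injective (taggedExcited (d := d)) :=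
  fun _ _ h => congrFun h none

lemma IsPureState.exists_ne_zero {X : Type*} [Fintype X] {ψ : X → ℂ} (hψ : IsPureState ψ) :
    ∃ x, ψ x ≠ 0 := by
  by_contra! h
  simp [IsPureState, h] at hψ

lemma extend_ne_zero {X Y : Type*} {ε : X → Y} (hε : Function.Injective ε) {ψ : X → ℂ} {y : Y}
    (h : Function.extend ε ψ 0 y ≠ 0) : ∃ x, ψ x ≠ 0 ∧ ε x = y := by
  by_cases hy : ∃ x, ε x = y
  · obtain ⟨x, rfl⟩ := hy
    exact ⟨x, by rwa [hε.extend_apply] at h, rfl⟩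
  · exact absurd (Function.extend_apply' _ _ _ hy) h

lemma coherenceRank_eq_card (ψ : Fin d → ℂ) :
    coherenceRank ψ = (Finset.univ.filter fun j => ψ j ≠ 0).card := by
  rw [coherenceRank, ← Set.ncard_coe_finset]
  simp

/-- A superposition of one-excitation states of the qubits is `k`-producible if and only if at
most `k` of them occur. -/
lemma isProduciblePure_extend_excited {k : ℕ} {ψ : Fin d → ℂ} (hψ : IsPureState ψ) :
    IsProduciblePure (κ := fun _ : Fin d => Fin 2) k (Function.extend excited ψ 0) ↔
      coherenceRank ψ ≤ k := by
  rw [coherenceRank_eq_card]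
  obtain ⟨i, hi⟩ := hψ.exists_ne_zero
  constructor
  · rintro ⟨P, φ, hφ, hprod⟩
    obtain ⟨B, hB, hiB⟩ := P.exists_mem (Finset.mem_univ i)
    refine (Finset.card_le_card fun j hj => ?_).trans (hφ B hB).1
    by_contra hjB
    have hj : ψ j ≠ 0 := by simpa using hj
    have hij : i ≠ j := fun h => hjB (h ▸ hiB)
    -- With `i` in `B` and `j` outside, the exchange yields a support state in which both qubits `i`
    -- and `j` are excited.
    obtain ⟨l, -, hl⟩ := extend_ne_zero excited_injective
      (exchange_ne_zero hprod (x := excited i) (y := excited j)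
        (by rwa [excited_injective.extend_apply]) (by rwa [excited_injective.extend_apply]) hB)
    have h₁ : excited l i = 1 := (congrFun hl i).trans ((if_pos hiB).trans (excited_apply_eq_one.2 rfl))
    have h₂ : excited l j = 1 := (congrFun hl j).trans ((if_neg hjB).trans (excited_apply_eq_one.2 rfl))
    exact hij ((excited_apply_eq_one.1 h₁).trans (excited_apply_eq_one.1 h₂).symm)
  · intro hk
    refine isProduciblePure_of_support ((isPureState_extend excited_injective).2 hψ) _
      ⟨i, by simpa using hi⟩ hk 0 fun x hx l hl => ?_
    obtain ⟨j, hj, rfl⟩ := extend_ne_zero excited_injective hx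
    exact excited_apply_of_ne fun h => hl (by simpa [h] using hj)

/-- A superposition of the states `|j⟩|0⋯1⋯0⟩` of `d + 1` parties is `k + 1`-producible, for
`1 ≤ k`, if and only if at most `k` of them occur. -/
lemma isProduciblePure_extend_taggedExcited {k : ℕ} (hk : 1 ≤ k) {ψ : Fin d → ℂ}
    (hψ : IsPureState ψ) :
    IsProduciblePure (κ := PartyBasis d) (k + 1) (Function.extend taggedExcited ψ 0) ↔
      coherenceRank ψ ≤ k := by
  rw [coherenceRank_eq_card]
  constructor
  · rintro ⟨P, φ, hφ, hprod⟩
    by_contra! hlt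
    obtain ⟨B, hB, hnB⟩ := P.exists_mem (Finset.mem_univ none)
    -- The block of the qudit must contain every qubit that can be excited.
    have hsub : Finset.insertNone (Finset.univ.filter fun j => ψ j ≠ 0) ⊆ B := by
      intro o ho
      cases o with
      | none => exact hnB
      | some i =>
        by_contra hiB
        have hi : ψ i ≠ 0 := by simpa using ho
        -- More than `k ≥ 1` labels occur, so some `j ≠ i` does. The exchange then yields a support
        -- state whose qudit reads `j` while qubit `i` is excited.
        obtain ⟨j, hj, hji⟩ := Finset.exists_mem_ne (lt_of_le_of_lt hk hlt) i
        have hj : ψ j ≠ 0 := by simpa using hj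
        obtain ⟨l, -, hl⟩ := extend_ne_zero taggedExcited_injective
          (exchange_ne_zero hprod (x := taggedExcited j) (y := taggedExcited i)
            (by rwa [taggedExcited_injective.extend_apply])
            (by rwa [taggedExcited_injective.extend_apply]) hB)
        have h₁ : l = j := (congrFun hl none).trans (if_pos hnB)
        have h₂ : excited l i = excited i i := (congrFun hl (some i)).trans (if_neg hiB)
        rw [excited_apply_eq_one.2 (rfl : i = i), excited_apply_eq_one] at h₂
        exact hji (h₁.symm.trans h₂.symm)
    have := (Finset.card_le_card hsub).trans (hφ B hB).1
    rw [Finset.card_insertNone] at this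
    omega
  · intro hk'
    obtain ⟨i, hi⟩ := hψ.exists_ne_zero
    refine isProduciblePure_of_support ((isPureState_extend taggedExcited_injective).2 hψ)
      (Finset.insertNone (Finset.univ.filter fun j => ψ j ≠ 0)) ⟨none, by simp⟩
      (by rw [Finset.card_insertNone]; omega)
      -- The value `i` at `none` is arbitrary, since the qudit belongs to the chosen block.
      (fun | none => i | some _ => (0 : Fin 2)) fun x hx o ho => ?_
    obtain ⟨j, hj, rfl⟩ := extend_ne_zero taggedExcited_injective hx
    cases o with
    | none => simp at ho
    | some l => exact excited_apply_of_ne fun h => ho (by simpa [h] using hj)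

end Excitation

/-! ### The states of the protocol -/

section Protocol

variable {d : ℕ}

lemma embedding_zero_mul (ρ : Matrix (Fin d) (Fin d) ℂ) :
    (ρ ⊗ₖ qubitTensor fun _ => Matrix.single 0 0 1) =
      embedOperator (fun j : Fin d => (j, (0 : Qubits d))) ρ := by
  have hinj : Function.Injective fun j : Fin d => (j, (0 : Qubits d)) :=
    fun _ _ h => (Prod.ext_iff.1 h).1
  have hrange : ∀ (i : Fin d) (x : Qubits d), x ≠ 0 →
      (i, x) ∉ Set.range fun j : Fin d => (j, (0 : Qubits d)) := by
    rintro i x hx ⟨j, hj⟩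
    exact hx (Prod.ext_iff.1 hj).2.symm
  ext ⟨i, x⟩ ⟨j, y⟩
  rw [Matrix.kroneckerMap_apply, qubitTensor, Matrix.of_apply]
  by_cases hx : x = 0
  · by_cases hy : y = 0
    · subst hx hy
      rw [embedOperator_apply_apply hinj]
      simp
    · rw [embedOperator_apply_right _ _ (hrange j y hy)]
      obtain ⟨l, hl⟩ := Function.ne_iff.1 hy
      rw [Finset.prod_eq_zero (Finset.mem_univ l), mul_zero]
      exact Matrix.single_apply_of_col_ne _ _ (Ne.symm hl) _
  · rw [embedOperator_apply_left _ (hrange i x hx)]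
    obtain ⟨l, hl⟩ := Function.ne_iff.1 hx
    rw [Finset.prod_eq_zero (Finset.mem_univ l), mul_zero]
    exact Matrix.single_apply_of_row_ne (Ne.symm hl) _ _ _

lemma controlled_apply (A : Fin d → Matrix (Qubits d) (Qubits d) ℂ) (i j : Fin d)
    (x y : Qubits d) :
    (∑ m, quditProj m ⊗ₖ A m) (i, x) (j, y) = if i = j then A i x y else 0 := by
  simp only [Matrix.sum_apply, Matrix.kroneckerMap_apply, quditProj, Matrix.single_apply]
  rw [Finset.sum_eq_single i]
  · by_cases h : i = j <;> simp [h]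
  · intro m _ hm
    simp [hm]
  · simp

lemma activation_mul_embedding :
    activation d * basisEmbedding (fun j : Fin d => (j, (0 : Qubits d))) =
      basisEmbedding fun j : Fin d => (j, excited j) := by
  ext ⟨i, x⟩ j
  simp only [Matrix.mul_apply, basisEmbedding, Matrix.of_apply]
  rw [Finset.sum_eq_single (j, (0 : Qubits d)) (fun b _ hb => by simp [hb]) (by simp)]
  rw [if_pos rfl, mul_one, activation, controlled_apply]
  by_cases hij : i = j
  · subst hij
    rw [if_pos rfl, qubitTensor, Matrix.of_apply]
    by_cases hx : x = excited i
    · subst hx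
      rw [if_pos rfl]
      refine Finset.prod_eq_one fun l _ => ?_
      by_cases hl : l = i
      · subst hl
        rw [Function.update_self, excited_apply_eq_one.2 rfl]
        simp [pauliX]
      · rw [Function.update_of_ne hl, excited_apply_of_ne hl]
        exact Matrix.one_apply_eq (0 : Fin 2)
    · rw [if_neg (by simpa using hx)]
      obtain ⟨l, hl⟩ := Function.ne_iff.1 hx
      refine Finset.prod_eq_zero (Finset.mem_univ l) ?_
      by_cases hli : l = i
      · subst hli
        rw [excited_apply_eq_one.2 rfl] at hl
        rw [Function.update_self, show x l = 0 by omega]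
        simp [pauliX]
      · rw [excited_apply_of_ne hli] at hl
        rw [Function.update_of_ne hli]
        exact Matrix.one_apply_ne hl
  · rw [if_neg hij, if_neg (by simp [hij])]

lemma activated_eq (ρ : Matrix (Fin d) (Fin d) ℂ) :
    activated ρ = embedOperator (fun j => (j, excited j)) ρ := by
  rw [activated, embedding_zero_mul, embedOperator, embedOperator, ← activation_mul_embedding,
    Matrix.conjTranspose_mul]
  simp only [Matrix.mul_assoc]

lemma asParties_activated (ρ : Matrix (Fin d) (Fin d) ℂ)
    [DecidableEq (∀ o, PartyBasis d o)] :
    asParties (activated ρ) = embedOperator taggedExcited ρ := by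
  have h : ∀ (x : ∀ o, PartyBasis d o) (j : Fin d),
      ((x none, fun l => x (some l)) : Fin d × Qubits d) = (j, excited j) ↔
        x = taggedExcited j := by
    intro x j
    constructor
    · intro h
      funext o
      cases o with
      | none => exact (Prod.ext_iff.1 h).1
      | some l => exact congrFun (Prod.ext_iff.1 h).2 l
    · rintro rfl
      rfl
  ext x y
  rw [asParties, Matrix.submatrix_apply, activated_eq, embedOperator_apply, embedOperator_apply]
  simp only [h]

lemma fourier_mul_embedding_apply (m : Fin d) (x : Qubits d) (j : Fin d) :
    ((qft d ⊗ₖ (1 : Matrix (Qubits d) (Qubits d) ℂ)) *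
      basisEmbedding fun j : Fin d => (j, excited j)) (m, x) j =
      qft d m j * basisEmbedding excited x j := by
  simp only [Matrix.mul_apply, basisEmbedding, Matrix.of_apply]
  rw [Finset.sum_eq_single (j, excited j) (fun b _ hb => by simp [hb]) (by simp)]
  simp [Matrix.one_apply]

lemma qubitPhases_eq_diagonal (m : Fin d) :
    qubitPhases m = Matrix.diagonal fun x => ∏ j, ![1, (phase j m)⁻¹] (x j) := by
  ext x y
  rw [qubitPhases, qubitTensor, Matrix.of_apply, Matrix.diagonal_apply]
  split_ifs with h
  · subst h
    simp
  · obtain ⟨l, hl⟩ := Function.ne_iff.1 h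
    exact Finset.prod_eq_zero (Finset.mem_univ l) (Matrix.diagonal_apply_ne _ hl)

/-- On `e_j` only qubit `j` contributes a phase, and it is the inverse of the Fourier phase; the
result no longer depends on `m`. -/
lemma phases_mul_embedding (m j : Fin d) (x : Qubits d) :
    (∏ l, ![1, (phase l m)⁻¹] (x l)) * (qft d m j * basisEmbedding excited x j) =
      1 / (Real.sqrt d : ℂ) * basisEmbedding excited x j := by
  rw [basisEmbedding, Matrix.of_apply]
  split_ifs with h
  · subst h
    have hp : phase j m ≠ 0 := Complex.exp_ne_zero _
    rw [Finset.prod_eq_single j, excited_apply_eq_one.2 rfl]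
    · simp [qft]
      field_simp
    · intro l _ hl
      rw [excited_apply_of_ne hl]
      rfl
    · simp
  · simp

lemma decoupling_mul_embedding_apply (m : Fin d) (x : Qubits d) (j : Fin d) :
    (decoupling d * basisEmbedding fun j : Fin d => (j, excited j)) (m, x) j =
      1 / (Real.sqrt d : ℂ) * basisEmbedding excited x j := by
  rw [decoupling, Matrix.mul_assoc, Matrix.mul_apply, Fintype.sum_prod_type]
  simp only [disentangling, controlled_apply, fourier_mul_embedding_apply,
    qubitPhases_eq_diagonal, Matrix.diagonal_apply, ite_mul, zero_mul]
  rw [Finset.sum_eq_single m (fun b _ hb => by simp [hb.symm]) (by simp)]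
  simp only [if_true]
  rw [Finset.sum_ite_eq Finset.univ x, if_pos (Finset.mem_univ x), phases_mul_embedding]

lemma conj_inv_sqrt (d : ℕ) :
    star (1 / (Real.sqrt d : ℂ)) = 1 / (Real.sqrt d : ℂ) := by
  simp

lemma decoupling_conj_activated (ρ : Matrix (Fin d) (Fin d) ℂ) :
    decoupling d * activated ρ * (decoupling d).conjTranspose =
      ketBra (maxCoherent d) ⊗ₖ embedOperator excited ρ := by
  have h : decoupling d * activated ρ * (decoupling d).conjTranspose =
      (decoupling d * basisEmbedding fun j : Fin d => (j, excited j)) * ρ *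
        (decoupling d * basisEmbedding fun j : Fin d => (j, excited j)).conjTranspose := by
    rw [activated_eq, embedOperator, Matrix.conjTranspose_mul]
    simp only [Matrix.mul_assoc]
  rw [h]
  ext ⟨m, x⟩ ⟨n, y⟩
  rw [Matrix.kroneckerMap_apply, ketBra, Matrix.vecMulVec_apply, Pi.star_apply, maxCoherent,
    maxCoherent, embedOperator, Matrix.mul_apply, Matrix.mul_apply]
  simp only [Matrix.mul_apply (N := ρ), Matrix.conjTranspose_apply,
    decoupling_mul_embedding_apply, star_mul', conj_inv_sqrt, Finset.mul_sum, Finset.sum_mul]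
  refine Finset.sum_congr rfl fun i _ => Finset.sum_congr rfl fun j _ => ?_
  ring

lemma inv_sqrt_mul_self (hd : d ≠ 0) :
    (d : ℂ) * ((1 / (Real.sqrt d : ℂ)) * (1 / (Real.sqrt d : ℂ))) = 1 := by
  have h : (Real.sqrt d : ℂ) * (Real.sqrt d : ℂ) = d := by
    rw [← Complex.ofReal_mul, Real.mul_self_sqrt (Nat.cast_nonneg d), Complex.ofReal_natCast]
  have hd' : (d : ℂ) ≠ 0 := Nat.cast_ne_zero.2 hd
  rw [one_div_mul_one_div, h, mul_one_div_cancel hd']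

lemma traceQudit_decoupled (hd : d ≠ 0) (ρ : Matrix (Fin d) (Fin d) ℂ) :
    traceQudit (decoupling d * activated ρ * (decoupling d).conjTranspose) =
      embedOperator excited ρ := by
  rw [decoupling_conj_activated]
  ext x y
  simp only [traceQudit, outcome, Matrix.sum_apply, Matrix.submatrix_apply,
    Matrix.kroneckerMap_apply, ketBra, Matrix.vecMulVec_apply, Pi.star_apply, maxCoherent,
    conj_inv_sqrt, Finset.sum_const, Finset.card_univ, Fintype.card_fin, nsmul_eq_mul]
  rw [← mul_assoc, inv_sqrt_mul_self hd, one_mul]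

lemma oneWayLOCC_activated (hd : d ≠ 0) (ρ : Matrix (Fin d) (Fin d) ℂ) :
    oneWayLOCC (activated ρ) = embedOperator excited ρ := by
  -- After the correction each of the `d` outcomes contributes the same operator with weight `1 /
  -- d`, so forgetting the outcome costs nothing.
  have h : ∀ m : Fin d, qubitPhases m *
      outcome m ((qft d ⊗ₖ (1 : Matrix (Qubits d) (Qubits d) ℂ)) * activated ρ *
        (qft d ⊗ₖ (1 : Matrix (Qubits d) (Qubits d) ℂ)).conjTranspose) *
      (qubitPhases m).conjTranspose =
      ((1 / (Real.sqrt d : ℂ)) * (1 / (Real.sqrt d : ℂ))) • embedOperator excited ρ := by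
    intro m
    have hA : (qft d ⊗ₖ (1 : Matrix (Qubits d) (Qubits d) ℂ)) * activated ρ *
        (qft d ⊗ₖ (1 : Matrix (Qubits d) (Qubits d) ℂ)).conjTranspose =
        ((qft d ⊗ₖ (1 : Matrix (Qubits d) (Qubits d) ℂ)) *
          basisEmbedding fun j : Fin d => (j, excited j)) * ρ *
        ((qft d ⊗ₖ (1 : Matrix (Qubits d) (Qubits d) ℂ)) *
          basisEmbedding fun j : Fin d => (j, excited j)).conjTranspose := by
      rw [activated_eq, embedOperator, Matrix.conjTranspose_mul]
      simp only [Matrix.mul_assoc]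
    rw [hA, qubitPhases_eq_diagonal, Matrix.diagonal_conjTranspose]
    ext x y
    rw [Matrix.mul_diagonal, Matrix.diagonal_mul, Matrix.smul_apply, outcome,
      Matrix.submatrix_apply, embedOperator, Matrix.mul_apply, Matrix.mul_apply, smul_eq_mul,
      Finset.mul_sum, Finset.mul_sum, Finset.sum_mul]
    refine Finset.sum_congr rfl fun i _ => ?_
    rw [Matrix.mul_apply, Matrix.mul_apply, Matrix.conjTranspose_apply,
      Matrix.conjTranspose_apply]
    simp only [fourier_mul_embedding_apply]
    have hx : (∏ l, ![1, (phase l m)⁻¹] (x l)) *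
        ∑ j, qft d m j * basisEmbedding excited x j * ρ j i =
        1 / (Real.sqrt d : ℂ) * ∑ j, basisEmbedding excited x j * ρ j i := by
      simp only [Finset.mul_sum, ← mul_assoc]
      refine Finset.sum_congr rfl fun j _ => ?_
      rw [← phases_mul_embedding m, mul_assoc (∏ l, ![1, (phase l m)⁻¹] (x l))]
    have hy : star (qft d m i * basisEmbedding excited y i) *
        star (∏ l, ![1, (phase l m)⁻¹] (y l)) =
        1 / (Real.sqrt d : ℂ) * star (basisEmbedding excited y i) := by
      rw [← star_mul, phases_mul_embedding, star_mul', conj_inv_sqrt]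
    rw [Pi.star_apply, ← mul_assoc, hx, mul_assoc, hy]
    ring
  rw [oneWayLOCC, Finset.sum_congr rfl fun m _ => h m, Finset.sum_const, Finset.card_univ,
    Fintype.card_fin, ← Nat.cast_smul_eq_nsmul ℂ, smul_smul, inv_sqrt_mul_self hd, one_smul]

end Protocol

lemma entanglementDepth_excited_iff {d k : ℕ} {ρ : Matrix (Fin d) (Fin d) ℂ} :
    entanglementDepth (ι := Fin d) (κ := fun _ => Fin 2) (embedOperator excited ρ) = k + 1 ↔
      coherenceNumber ρ = k + 1 := by
  rw [entanglementDepth_eq_succ_iff, coherenceNumber_eq_succ_iff,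
    isProducible_embedOperator_iff excited_injective fun _ => isProduciblePure_extend_excited,
    isProducible_embedOperator_iff excited_injective fun _ => isProduciblePure_extend_excited]

/-- The qudit adds one party to the entangled block. The bound `1 ≤ k` is needed at the lower level:
`|j⟩|e_j⟩` is already `1`-producible, although its coherence rank is not `0`. -/
lemma entanglementDepth_activated_iff {d k : ℕ} (hk : 1 ≤ k) {ρ : Matrix (Fin d) (Fin d) ℂ} :
    entanglementDepth (asParties (activated ρ)) = k + 1 + 1 ↔ coherenceNumber ρ = k + 1 := by
  classical
  rw [asParties_activated, entanglementDepth_eq_succ_iff, coherenceNumber_eq_succ_iff,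
    isProducible_embedOperator_iff taggedExcited_injective fun _ =>
      isProduciblePure_extend_taggedExcited (k.succ_pos),
    isProducible_embedOperator_iff taggedExcited_injective fun _ =>
      isProduciblePure_extend_taggedExcited hk]

end CoherenceConversion

theorem theorem2 (d k : ℕ) (hk : 2 ≤ k) (hkd : k ≤ d) (ρ : Matrix (Fin d) (Fin d) ℂ)
    (hρ : CoherenceConversion.IsDensityMatrix ρ) :
    (CoherenceConversion.decoupling d * CoherenceConversion.activated ρ *
        (CoherenceConversion.decoupling d).conjTranspose =
      CoherenceConversion.ketBra (CoherenceConversion.maxCoherent d) ⊗ₖ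
        CoherenceConversion.oneWayLOCC (CoherenceConversion.activated ρ)) ∧
    List.TFAE [
      CoherenceConversion.coherenceNumber ρ = k,
      CoherenceConversion.entanglementDepth
        (CoherenceConversion.asParties (CoherenceConversion.activated ρ)) = k + 1,
      CoherenceConversion.entanglementDepth (ι := Fin d) (κ := fun _ => Fin 2)
        (CoherenceConversion.oneWayLOCC (CoherenceConversion.activated ρ)) = k,
      CoherenceConversion.entanglementDepth (ι := Fin d) (κ := fun _ => Fin 2)
        (CoherenceConversion.traceQudit
          (CoherenceConversion.decoupling d * CoherenceConversion.activated ρ *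
            (CoherenceConversion.decoupling d).conjTranspose)) = k] := by
  have hd : d ≠ 0 := by omega
  rw [CoherenceConversion.traceQudit_decoupled hd, CoherenceConversion.oneWayLOCC_activated hd]
  refine ⟨CoherenceConversion.decoupling_conj_activated ρ, ?_⟩
  -- The successor form matches the two-level criteria, and `2 ≤ k` supplies the bound `1 ≤ l` for
  -- the depth with the qudit.
  obtain ⟨l, rfl⟩ : ∃ l, k = l + 1 := ⟨k - 1, by omega⟩
  tfae_have 1 ↔ 2 := (CoherenceConversion.entanglementDepth_activated_iff (by omega)).symm
  tfae_have 1 ↔ 3 := CoherenceConversion.entanglementDepth_excited_iff.symm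
  tfae_have 3 ↔ 4 := Iff.rfl
  tfae_finish
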